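/- For a metric space $Y$, a subset $E\subseteq Y$ and $r>0$, let $n_r(E)\in\mathbb N\cup\{\infty\}$ be the minimum number of open balls of $Y$ of radius $r$ necessary to cover $E$, and let $\overline B_Y(y,r)$ be the closed ball of $Y$ with center $y$ and radius $r$. Let $(X,d)$ be a metric space and $x\in X$. The lower and upper tangential dimensions of $X$ at $x$ are the elements of $[0,\infty]$ $$\underline\delta_X(x)=\liminf_{\lambda\to0^+}\,\liminf_{r\to0^+}\frac{\log n_{\lambda r}(\overline B_X(x,r))}{\log(1/\lambda)},\qquad \overline\delta_X(x)=\limsup_{\lambda\to0^+}\,\limsup_{r\to0^+}\frac{\log n_{\lambda r}(\overline B_X(x,r))}{\log(1/\lambda)}.$$ In the pointed Gromov–Hausdorff topology, a neighbourhood base of a pointed metric space $(Y,y)$ consists of the sets $\{(W,w): d^R((Y,y),(W,w))<\varepsilon\}$, $R>0$, $\varepsilon\in(0,1)$, where $d^R((Y,y),(W,w))$ is the infimum of the $\varepsilon>0$ for which there are isometric embeddings $\varphi_Y,\varphi_W$ of $Y,W$ into a metric space $Z$ such that $d_Z(\varphi_Y(y),\varphi_W(w))<\varepsilon$, $\varphi_Y(\overline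 B_Y(y,R))$ is contained in the open $\varepsilon$-neighbourhood of $\varphi_W(W)$, and $\varphi_W(\overline B_W(w,R))$ is contained in the open $\varepsilon$-neighbourhood of $\varphi_Y(Y)$. A tangent set of $X$ at $x$ is a proper pointed metric space $T$ (its base point is again denoted by $x$) that is a limit point, as $t\to\infty$, of the pointed metric spaces $(X,x,t\,d)$ in this topology; $\mathcal T_xX$ denotes the family of all tangent sets of $X$ at $x$ (up to isometry). Theorem. Let $(X,d)$ be a metric space and let $x\in X$ be such that $$\limsup_{r\to0^+} n_{\lambda r}(\overline B_X(x,r))<\infty\qquad\text{for all }\lambda>0.$$ Then $$\overline\delta_X(x)=\limsup_{r\to0^+}\ \sup_{T\in\mathcal T_xX}\frac{\log n_r(\overline B_T(x,1))}{\log(1/r)},\qquad \underline\delta_X(x)=\liminf_{r\to0^+}\ \inf_{T\in\mathcal T_xX}\frac{\log n_r(\overline B_T(x,1))}{\log(1/r)}.$$ -/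

import Mathlib

open Filter Topology Metric
open scoped ENNReal

universe u

namespace TangentialDim

/-- The minimum number of open balls of radius `r` of the metric space `X` necessary to cover `E`
(it is `⊤` when finitely many balls do not suffice). -/
noncomputable def coverNum {X : Type u} [MetricSpace X] (r : ℝ) (E : Set X) : ℕ∞ :=
  ⨅ (s : Finset X) (_ : E ⊆ ⋃ c ∈ s, ball c r), (s.card : ℕ∞)

/-- The ratio `log N / log (1 / r)`, an extended real number. -/
noncomputable def logRatio (N : ℕ∞) (r : ℝ) : EReal :=
  ENNReal.log (N : ℝ≥0∞) / ((Real.log (1 / r) : ℝ) : EReal)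

/-- The lower tangential dimension of `E ⊆ X` at `x`. -/
noncomputable def lowerTangentialDim {X : Type u} [MetricSpace X] (E : Set X) (x : X) : EReal :=
  liminf (fun l : ℝ =>
    liminf (fun r : ℝ => logRatio (coverNum (l * r) (E ∩ closedBall x r)) l) (𝓝[>] 0)) (𝓝[>] 0)

/-- The upper tangential dimension of `E ⊆ X` at `x`. -/
noncomputable def upperTangentialDim {X : Type u} [MetricSpace X] (E : Set X) (x : X) : EReal :=
  limsup (fun l : ℝ =>
    limsup (fun r : ℝ => logRatio (coverNum (l * r) (E ∩ closedBall x r)) l) (𝓝[>] 0)) (𝓝[>] 0)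

/-- The local compactness condition at `x`: for every `l > 0`, the limit superior as `r → 0` of
the number of balls of radius `l * r` needed to cover the closed ball of radius `r` is finite. -/
def LocalCompactnessCondition (X : Type u) [MetricSpace X] (x : X) : Prop :=
  ∀ l : ℝ, 0 < l → limsup (fun r : ℝ => coverNum (l * r) (closedBall x r)) (𝓝[>] 0) < ⊤

/-- A pointed metric space. -/
structure PointedMetricSpace where
  carrier : Type u
  metric : MetricSpace carrier
  pt : carrier

attribute [instance] PointedMetricSpace.metric

/-- The metric `t * dist` on `X`, for `t > 0`. -/
noncomputable abbrev scaledMetric (X : Type u) [MetricSpace X] (t : ℝ) (ht : 0 < t) :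
    MetricSpace X where
  dist a b := t * dist a b
  dist_self a := by simp
  dist_comm a b := by rw [dist_comm]
  dist_triangle a b c := by
    rw [← mul_add]
    exact mul_le_mul_of_nonneg_left (dist_triangle a b c) ht.le
  eq_of_dist_eq_zero h := by
    rcases mul_eq_zero.mp h with h | h
    · exact absurd h ht.ne'
    · exact eq_of_dist_eq_zero h

/-- The pointed metric space `(X, x, t d)`. -/
noncomputable def scaled (X : Type u) [MetricSpace X] (x : X) (t : ℝ) (ht : 0 < t) :
    PointedMetricSpace.{u} where
  carrier := X
  metric := scaledMetric X t ht
  pt := x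

/-- There are isometric embeddings of `P` and `Q` into a metric space `Z` for which the images of
the base points are at distance less than `ε`, and the image of the closed ball of radius `R` about
either base point lies in the open `ε`-neighbourhood of the image of the other space. -/
def EpsClose (R ε : ℝ) (P Q : PointedMetricSpace.{u}) : Prop :=
  ∃ (Z : Type u) (_ : MetricSpace Z) (f : P.carrier → Z) (g : Q.carrier → Z),
    Isometry f ∧ Isometry g ∧ dist (f P.pt) (g Q.pt) < ε ∧
    f '' closedBall P.pt R ⊆ thickening ε (Set.range g) ∧
    g '' closedBall Q.pt R ⊆ thickening ε (Set.range f)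

/-- The infimum of the `ε > 0` for which `P` and `Q` are `ε`-close at scale `R`. -/
noncomputable def pghDist (R : ℝ) (P Q : PointedMetricSpace.{u}) : ℝ≥0∞ :=
  ⨅ (ε : ℝ) (_ : 0 < ε ∧ EpsClose R ε P Q), ENNReal.ofReal ε

/-- The basic neighbourhoods of `P` in the pointed Gromov-Hausdorff topology
(a base is obtained by letting `R > 0` and `0 < ε < 1` vary). -/
def pghNhd (P : PointedMetricSpace.{u}) (R ε : ℝ) : Set PointedMetricSpace.{u} :=
  {Q | pghDist R P Q < ENNReal.ofReal ε}

/-- The tangent cone of `X` at `x`: the family of tangent sets of `X` at `x`, that is of the proper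
pointed metric spaces `T` that are limit points of `(X, x, t d)`, for `t → ∞`, in the pointed
Gromov-Hausdorff topology. Proper spaces have at most the cardinality of the continuum, so that
every isometry class of them is represented in the universe of `X`. -/
def tangentSets (X : Type u) [MetricSpace X] (x : X) : Set PointedMetricSpace.{u} :=
  {T | ProperSpace T.carrier ∧
    ∀ R ε : ℝ, 0 < R → 0 < ε → ε < 1 →
      ∃ᶠ t : {t : ℝ // 0 < t} in atTop, scaled X x t.1 t.2 ∈ pghNhd T R ε}

end TangentialDim

/-!
For `T` a tangent set, write `M T l` for the number of balls of radius `l` needed to cover the unit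
ball of `T`, and `N l r` for the number of balls of radius `l * r` needed to cover the ball of radius
`r` about `x` in `X`. The theorem holds because `N` and `M` determine each other up to a change of
`l` by a factor `4`.

If `(X, x, t d)` is close to `T`, then a cover of a ball in one of the spaces is carried to a cover
of a slightly smaller ball in the other one by slightly larger balls
(`EpsClose.coverNum_scaled_compare`). Hence for each tangent set `T` there are arbitrarily small `r`
with `M T (4 * l) ≤ N l r`, and arbitrarily small `r` with `N (4 * l) r ≤ M T l`. Conversely, any
set of arbitrarily small radii contains an `r` for which one of these inequalities holds with some
tangent set `T`. This is a precompactness statement: the covering hypothesis says that the dilated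
spaces are uniformly totally bounded near the base point, and then they converge along any
ultrafilter to their ultralimit, which is a proper space
(`UniformlyCovered.properSpace_ultralimit`, `UniformlyCovered.eventually_epsClose`).

Consequently `limsup_r log (N (4 * l) r) ≤ sup_T log (M T l)` and
`sup_T log (M T (4 * l)) ≤ limsup_r log (N l r)`, and likewise for the inferior limit and the
infimum. The factor `4` changes `log (1 / l)` by a bounded amount, so it disappears in the ratios as
`l` tends to `0` (`limsup_div_log_le`, `liminf_div_log_le`).
-/

namespace TangentialDim

/-! ### Covering numbers -/

section CoverNum

variable {X : Type u} [MetricSpace X]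

lemma coverNum_le_card {r : ℝ} {E : Set X} (s : Finset X) (h : E ⊆ ⋃ c ∈ s, ball c r) :
    coverNum r E ≤ s.card :=
  iInf₂_le s h

lemma coverNum_mono {r : ℝ} {E F : Set X} (h : E ⊆ F) : coverNum r E ≤ coverNum r F :=
  le_iInf₂ fun s hs => coverNum_le_card s (h.trans hs)

lemma coverNum_anti {r r' : ℝ} (h : r ≤ r') (E : Set X) : coverNum r' E ≤ coverNum r E :=
  le_iInf₂ fun s hs => coverNum_le_card s
    (hs.trans (Set.iUnion₂_mono fun _ _ => ball_subset_ball h))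

lemma exists_cover_of_coverNum_le {r : ℝ} {E : Set X} {N : ℕ} (h : coverNum r E ≤ N) :
    ∃ s : Finset X, s.card ≤ N ∧ E ⊆ ⋃ c ∈ s, ball c r := by
  have h1 : coverNum r E < (N + 1 : ℕ) := h.trans_lt (by exact_mod_cast N.lt_succ_self)
  simp only [coverNum, iInf_lt_iff] at h1
  obtain ⟨s, hs, hc⟩ := h1
  exact ⟨s, Nat.lt_succ_iff.1 (by exact_mod_cast hc), hs⟩

lemma coverNum_scaled (x : X) (t : ℝ) (ht : 0 < t) (r ρ : ℝ) :
    coverNum r (closedBall (scaled X x t ht).pt ρ) = coverNum (r / t) (closedBall x (ρ / t)) := by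
  have hb : ∀ c : X, @ball X (scaledMetric X t ht).toPseudoMetricSpace c r = ball c (r / t) := by
    intro c
    ext y
    simp only [ball, Set.mem_ofPred_eq]
    rw [lt_div_iff₀' ht]
    rfl
  have hcb : @closedBall X (scaledMetric X t ht).toPseudoMetricSpace x ρ
      = closedBall x (ρ / t) := by
    ext y
    simp only [closedBall, Set.mem_ofPred_eq]
    rw [le_div_iff₀' ht]
    rfl
  change (⨅ (s : Finset X)
    (_ : @closedBall X (scaledMetric X t ht).toPseudoMetricSpace x ρ ⊆
      ⋃ c ∈ s, @ball X (scaledMetric X t ht).toPseudoMetricSpace c r), (s.card : ℕ∞)) = _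
  simp only [hb, hcb]
  rfl

end CoverNum

/-! ### Covering numbers of close spaces -/

lemma EpsClose.symm {R ε : ℝ} {P Q : PointedMetricSpace.{u}} (h : EpsClose R ε P Q) :
    EpsClose R ε Q P := by
  obtain ⟨Z, _, f, g, hf, hg, hd, h1, h2⟩ := h
  exact ⟨Z, _, g, f, hg, hf, by rwa [dist_comm], h2, h1⟩

lemma EpsClose.mono {R ε ε' : ℝ} {P Q : PointedMetricSpace.{u}} (h : EpsClose R ε P Q)
    (hε : ε ≤ ε') : EpsClose R ε' P Q := by
  obtain ⟨Z, _, f, g, hf, hg, hd, h1, h2⟩ := h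
  exact ⟨Z, _, f, g, hf, hg, hd.trans_le hε, h1.trans (thickening_mono hε _),
    h2.trans (thickening_mono hε _)⟩

lemma EpsClose.of_mem_pghNhd {R ε : ℝ} {P Q : PointedMetricSpace.{u}} (h : Q ∈ pghNhd P R ε) :
    EpsClose R ε P Q := by
  simp only [pghNhd, pghDist, Set.mem_ofPred_eq, iInf_lt_iff] at h
  obtain ⟨ε', ⟨-, hc⟩, hlt⟩ := h
  exact hc.mono (ENNReal.ofReal_lt_ofReal_iff'.1 hlt).1.le

lemma EpsClose.mem_pghNhd {R ε ε' : ℝ} {P Q : PointedMetricSpace.{u}} (h : EpsClose R ε P Q)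
    (hε : 0 < ε) (hlt : ε < ε') : Q ∈ pghNhd P R ε' :=
  (iInf₂_le ε ⟨hε, h⟩ : pghDist R P Q ≤ _).trans_lt
    ((ENNReal.ofReal_lt_ofReal_iff (hε.trans hlt)).2 hlt)

/-- A cover of the ball of radius `ρ + 2 ε` in `Q` is carried to a cover of the ball of radius `ρ`
in `P` by moving its relevant centres to points of `P` at distance less than `ε`. -/
lemma EpsClose.coverNum_le {R ε l ρ : ℝ} {P Q : PointedMetricSpace.{u}} (h : EpsClose R ε P Q)
    (hε : 0 ≤ ε) (hl : 0 ≤ l) (hR : ρ + 2 * ε + l ≤ R) :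
    coverNum (l + 2 * ε) (closedBall P.pt ρ) ≤ coverNum l (closedBall Q.pt (ρ + 2 * ε)) := by
  classical
  obtain ⟨Z, _, f, g, hf, hg, hd, h1, h2⟩ := h
  refine le_iInf₂ fun s hs => ?_
  let m : Q.carrier → P.carrier := fun c =>
    if hc : ∃ p, dist (g c) (f p) < ε then hc.choose else P.pt
  have hm : ∀ c ∈ closedBall Q.pt R, dist (g c) (f (m c)) < ε := by
    intro c hc
    obtain ⟨_, ⟨p, rfl⟩, hp⟩ := mem_thickening_iff.1 (h2 ⟨c, hc, rfl⟩)
    have hex : ∃ p, dist (g c) (f p) < ε := ⟨p, hp⟩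
    simp only [m, dif_pos hex]
    exact hex.choose_spec
  refine (coverNum_le_card (s.image m) fun y hy => ?_).trans
    (by exact_mod_cast Finset.card_image_le)
  rw [mem_closedBall] at hy
  obtain ⟨_, ⟨q, rfl⟩, hq⟩ := mem_thickening_iff.1
    (h1 ⟨y, mem_closedBall.2 (by linarith), rfl⟩)
  have hqd : dist q Q.pt ≤ ρ + 2 * ε := by
    have := dist_triangle4 (g q) (f y) (f P.pt) (g Q.pt)
    rw [hg.dist_eq, hf.dist_eq, dist_comm (g q)] at this
    linarith
  obtain ⟨c, hcs, hc⟩ := Set.mem_iUnion₂.1 (hs (mem_closedBall.2 hqd))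
  rw [mem_ball] at hc
  refine Set.mem_iUnion₂.2 ⟨m c, Finset.mem_image_of_mem m hcs, ?_⟩
  have hcR : dist c Q.pt ≤ R := by
    have := dist_triangle_left c Q.pt q
    linarith
  have := dist_triangle4 (f y) (g q) (g c) (f (m c))
  rw [hf.dist_eq, hg.dist_eq] at this
  have := hm c hcR
  rw [mem_ball]
  linarith

/-- Covering numbers of the unit ball of a space close to `(X, x, t d)` are comparable to those of
balls of `X` of radii `2 / t` and `1 / (2 t)`, up to a factor `4` in the relative size of the
covering balls. -/
lemma EpsClose.coverNum_scaled_compare {X : Type u} [MetricSpace X] {x : X} {t : ℝ} (ht : 0 < t)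
    {l ε : ℝ} (hl : 0 < l) (hε : 0 < ε) (hεl : ε ≤ l / 2) (hε4 : ε ≤ 1 / 4) {T : PointedMetricSpace.{u}}
    (h : EpsClose (2 + 2 * l) ε T (scaled X x t ht)) :
    coverNum (4 * l) (closedBall T.pt 1) ≤ coverNum (l * (2 / t)) (closedBall x (2 / t)) ∧
    coverNum (4 * l * (1 / (2 * t))) (closedBall x (1 / (2 * t)))
      ≤ coverNum l (closedBall T.pt 1) := by
  constructor
  · have h1 := h.coverNum_le (l := 2 * l) (ρ := 1) hε.le (by linarith) (by linarith)
    refine (coverNum_anti (by linarith) _).trans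
      (h1.trans ((coverNum_mono
        (closedBall_subset_closedBall (by linarith : _ ≤ (2 : ℝ)))).trans ?_))
    rw [coverNum_scaled]
    exact le_of_eq (by congr 1; ring)
  · have h1 := h.symm.coverNum_le (l := l) (ρ := 1 / 2) hε.le hl.le (by linarith)
    refine le_trans ?_ ((coverNum_anti (by linarith : _ ≤ 2 * l) _).trans
      (h1.trans (coverNum_mono (closedBall_subset_closedBall (by linarith)))))
    rw [coverNum_scaled]
    exact le_of_eq (by congr 1 <;> field_simp; norm_num)

/-! ### Ultralimits of pointed metric spaces -/

section Ultralimit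

variable {ι : Type} (U : Ultrafilter ι) (P : ι → PointedMetricSpace.{u})

/-- The sections `i ↦ f i ∈ P i` that stay at bounded distance from the base points. The ultrafilter
is a parameter because the pseudometric on the sections depends on it. -/
@[ext]
structure BoundedSection (_U : Ultrafilter ι) (P : ι → PointedMetricSpace.{u}) : Type u where
  /-- The underlying section. -/
  val : ∀ i, (P i).carrier
  exists_dist_le : ∃ C : ℝ, ∀ i, dist (val i) (P i).pt ≤ C

variable {U P}

/-- The distance of two bounded sections: the limit along the ultrafilter of their distances. -/
noncomputable instance : Dist (BoundedSection U P) where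
  dist f g := limUnder (U : Filter ι) fun i => dist (f.val i) (g.val i)

lemma BoundedSection.tendsto_dist (f g : BoundedSection U P) :
    Tendsto (fun i => dist (f.val i) (g.val i)) U (𝓝 (dist f g)) := by
  obtain ⟨C, hC⟩ := f.exists_dist_le
  obtain ⟨D, hD⟩ := g.exists_dist_le
  have hK : (U.map fun i => dist (f.val i) (g.val i) : Filter ℝ) ≤ 𝓟 (Set.Icc 0 (C + D)) := by
    refine le_principal_iff.2 (Ultrafilter.mem_map.2 (Eventually.of_forall fun i => ?_))
    have := dist_triangle_right (f.val i) (g.val i) (P i).pt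
    exact ⟨dist_nonneg, by linarith [hC i, hD i]⟩
  obtain ⟨a, -, ha⟩ := (isCompact_Icc (a := (0 : ℝ)) (b := C + D)).ultrafilter_le_nhds _ hK
  exact tendsto_nhds_limUnder ⟨a, ha⟩

noncomputable instance : PseudoMetricSpace (BoundedSection U P) where
  dist_self f := tendsto_nhds_unique (f.tendsto_dist f) (by simp)
  dist_comm f g := tendsto_nhds_unique (f.tendsto_dist g)
    (by simpa only [dist_comm] using g.tendsto_dist f)
  dist_triangle f g h := le_of_tendsto_of_tendsto' (f.tendsto_dist h)
    ((f.tendsto_dist g).add (g.tendsto_dist h)) fun _ => dist_triangle _ _ _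

variable (U P)

/-- The section of base points. -/
def BoundedSection.base : BoundedSection U P := ⟨fun i => (P i).pt, 0, fun i => by simp⟩

/-- The ultralimit of pointed metric spaces, built as the completion of the space of bounded
sections; the completion identifies sections at distance zero. -/
noncomputable def ultralimit : PointedMetricSpace.{u} where
  carrier := UniformSpace.Completion (BoundedSection U P)
  metric := inferInstance
  pt := (BoundedSection.base U P : UniformSpace.Completion (BoundedSection U P))

/-- For each `R` and `ε`, almost all of the balls of radius `R` about the base points are covered by
a common number of balls of radius `ε`. -/
def UniformlyCovered : Prop :=
  ∀ R ε : ℝ, 0 < R → 0 < ε →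
    ∃ N : ℕ, ∀ᶠ i in (U : Filter ι), coverNum ε (closedBall (P i).pt R) ≤ N

variable {U P}

/-- The point of the ultralimit represented by a bounded section. -/
noncomputable def BoundedSection.toUltralimit (f : BoundedSection U P) :
    (ultralimit U P).carrier :=
  (f : UniformSpace.Completion (BoundedSection U P))

lemma BoundedSection.isometry_toUltralimit :
    Isometry (BoundedSection.toUltralimit : BoundedSection U P → (ultralimit U P).carrier) :=
  UniformSpace.Completion.coe_isometry

lemma BoundedSection.denseRange_toUltralimit :
    DenseRange (BoundedSection.toUltralimit : BoundedSection U P → (ultralimit U P).carrier) :=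
  UniformSpace.Completion.denseRange_coe

variable (U P) in
lemma BoundedSection.toUltralimit_base :
    (BoundedSection.base U P).toUltralimit = (ultralimit U P).pt :=
  rfl

/-- Centres of covers of the balls `closedBall (P i).pt R` assemble to finitely many bounded
sections; the base section is one of them. -/
lemma UniformlyCovered.exists_sections (H : UniformlyCovered U P) {R ε : ℝ} (hR : 0 < R)
    (hε : 0 < ε) : ∃ (N : ℕ) (c : Fin (N + 1) → BoundedSection U P),
      c (Fin.last N) = BoundedSection.base U P ∧
      ∀ᶠ i in (U : Filter ι), ∀ y ∈ closedBall (P i).pt R, ∃ k, dist y ((c k).val i) < ε := by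
  classical
  obtain ⟨N, hN⟩ := H R ε hR hε
  have hs : ∀ i, ∃ s : Finset (P i).carrier, s.card ≤ N ∧
      (coverNum ε (closedBall (P i).pt R) ≤ N → closedBall (P i).pt R ⊆ ⋃ c ∈ s, ball c ε) := by
    intro i
    by_cases h : coverNum ε (closedBall (P i).pt R) ≤ N
    · obtain ⟨s, h1, h2⟩ := exists_cover_of_coverNum_le h
      exact ⟨s, h1, fun _ => h2⟩
    · exact ⟨∅, by simp, fun h' => absurd h' h⟩
  choose s hsN hs using hs
  -- Centres too far away to matter are replaced by the base point, to keep the sections bounded.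
  let d : ℕ → ∀ i, (P i).carrier := fun k i => (s i).toList.getD k (P i).pt
  let c : Fin (N + 1) → BoundedSection U P := fun k =>
    ⟨fun i => if dist (d k i) (P i).pt ≤ R + ε then d k i else (P i).pt, R + ε, fun i => by
      split_ifs with h
      · exact h
      · rw [dist_self]; positivity⟩
  refine ⟨N, c, ?_, ?_⟩
  -- The lists of centres have length at most `N`, so their entry `N` is the default value.
  · refine BoundedSection.ext (funext fun i => ?_)
    have : d N i = (P i).pt := List.getD_eq_default _ _ (by simpa using hsN i)
    simp [c, this, BoundedSection.base]
  · filter_upwards [hN] with i hi y hy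
    obtain ⟨z, hz, hyz⟩ := Set.mem_iUnion₂.1 (hs i hi hy)
    obtain ⟨k, hk, rfl⟩ := List.getElem_of_mem (Finset.mem_toList.2 hz)
    have hkN : k < N + 1 := by
      have := hsN i
      rw [Finset.length_toList] at hk
      omega
    refine ⟨⟨k, hkN⟩, ?_⟩
    rw [mem_ball] at hyz
    rw [mem_closedBall] at hy
    have hd : d k i = (s i).toList[k] := List.getD_eq_getElem _ _ hk
    have : dist (d k i) (P i).pt ≤ R + ε := by
      have := dist_triangle_left (d k i) (P i).pt y
      rw [hd] at this ⊢
      linarith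
    simp only [c, if_pos this]
    rwa [hd]

/-- Along an ultrafilter, a section lies near the same one of finitely many centres almost always,
so the sections of centres form a net of the ultralimit. -/
lemma exists_dist_ultralimit_lt {R ε : ℝ} (hε : 0 < ε) {N : ℕ}
    {c : Fin (N + 1) → BoundedSection U P}
    (hc : ∀ᶠ i in (U : Filter ι), ∀ y ∈ closedBall (P i).pt (R + 1), ∃ k, dist y ((c k).val i) < ε)
    (z : (ultralimit U P).carrier) (hz : z ∈ closedBall (ultralimit U P).pt R) :
    ∃ k, dist z (c k).toUltralimit < 2 * ε := by
  obtain ⟨f, hf⟩ : ∃ f : BoundedSection U P,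
      dist z f.toUltralimit < min ε 1 :=
    BoundedSection.denseRange_toUltralimit.exists_dist_lt z (lt_min hε one_pos)
  have hfb : dist f (BoundedSection.base U P) < R + 1 := by
    rw [← BoundedSection.isometry_toUltralimit.dist_eq, BoundedSection.toUltralimit_base]
    have h1 := dist_triangle_left f.toUltralimit (ultralimit U P).pt z
    have h2 : dist z (ultralimit U P).pt ≤ R := hz
    have h3 := hf.trans_le (min_le_right _ _)
    exact h1.trans_lt (by linarith)
  have hev : ∀ᶠ i in (U : Filter ι), ∃ k, dist (f.val i) ((c k).val i) < ε := by
    filter_upwards [hc, (f.tendsto_dist (BoundedSection.base U P)).eventually (gt_mem_nhds hfb)]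
      with i h1 h2
    exact h1 _ (mem_closedBall.2 h2.le)
  obtain ⟨k, hk⟩ := Ultrafilter.eventually_exists_iff.1 hev
  have hle : dist f (c k) ≤ ε :=
    le_of_tendsto (f.tendsto_dist (c k)) (hk.mono fun _ h => h.le)
  refine ⟨k, ?_⟩
  have h1 := dist_triangle z f.toUltralimit (c k).toUltralimit
  rw [BoundedSection.isometry_toUltralimit.dist_eq] at h1
  linarith [hf.trans_le (min_le_left _ _)]

lemma UniformlyCovered.properSpace_ultralimit (H : UniformlyCovered U P) :
    ProperSpace (ultralimit U P).carrier := by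
  have : CompleteSpace (ultralimit U P).carrier :=
    inferInstanceAs (CompleteSpace (UniformSpace.Completion (BoundedSection U P)))
  refine ProperSpace.of_seq_closedBall (x := (ultralimit U P).pt) (r := fun R : ℝ => R) tendsto_id
    ((eventually_ge_atTop 1).mono fun R hR => ?_)
  refine TotallyBounded.isCompact_of_isComplete ?_ isClosed_closedBall.isComplete
  refine Metric.totallyBounded_iff.2 fun ε hε => ?_
  obtain ⟨N, c, -, hc⟩ := H.exists_sections (R := R + 1) (by linarith) (half_pos hε)
  refine ⟨Set.range fun k => (c k).toUltralimit,
    Set.finite_range _, fun z hz => ?_⟩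
  obtain ⟨k, hk⟩ := exists_dist_ultralimit_lt (half_pos hε) hc z hz
  refine Set.mem_iUnion₂.2 ⟨_, ⟨k, rfl⟩, ?_⟩
  rw [mem_ball]
  linarith

/-- The ultralimit is a limit along the ultrafilter in the pointed Gromov-Hausdorff topology. The
two spaces are glued along the finite nets given by the sections of centres, whose mutual distances
almost agree for almost all indices. -/
lemma UniformlyCovered.eventually_epsClose (H : UniformlyCovered U P) {R ε : ℝ} (hR : 0 < R)
    (hε : 0 < ε) : ∀ᶠ i in (U : Filter ι), EpsClose R ε (ultralimit U P) (P i) := by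
  set η := ε / 4 with hη
  have hη0 : 0 < η := by positivity
  obtain ⟨N, c, hlast, hc⟩ := H.exists_sections (R := R + 1) (by linarith) hη0
  have hdist : ∀ᶠ i in (U : Filter ι), ∀ p q,
      |dist (c p) (c q) - dist ((c p).val i) ((c q).val i)| ≤ 2 * η := by
    refine eventually_all.2 fun p => eventually_all.2 fun q => ?_
    have := ((c p).tendsto_dist (c q)).eventually
      (Metric.closedBall_mem_nhds _ (by positivity : 0 < 2 * η))
    filter_upwards [this] with i hi
    rwa [← Real.dist_eq, dist_comm]
  filter_upwards [hc, hdist] with i hci hdi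
  let Φ : Fin (N + 1) → (ultralimit U P).carrier := fun k =>
    (c k).toUltralimit
  let Ψ : Fin (N + 1) → (P i).carrier := fun k => (c k).val i
  have hΦΨ : ∀ p q, |dist (Φ p) (Φ q) - dist (Ψ p) (Ψ q)| ≤ 2 * η := by
    intro p q
    have : dist (Φ p) (Φ q) = dist (c p) (c q) := BoundedSection.isometry_toUltralimit.dist_eq _ _
    rw [this]
    exact hdi p q
  let inst : MetricSpace ((ultralimit U P).carrier ⊕ (P i).carrier) :=
    glueMetricApprox Φ Ψ η hη0 hΦΨ
  have hl : Isometry (Sum.inl : (ultralimit U P).carrier → _ ⊕ (P i).carrier) :=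
    Isometry.of_dist_eq fun _ _ => rfl
  have hr : Isometry (Sum.inr : (P i).carrier → (ultralimit U P).carrier ⊕ _) :=
    Isometry.of_dist_eq fun _ _ => rfl
  have hglue : ∀ k, dist (Sum.inl (Φ k) : (ultralimit U P).carrier ⊕ (P i).carrier)
      (Sum.inr (Ψ k)) = η := fun k => glueDist_glued_points Φ Ψ η k
  refine ⟨_, inst, Sum.inl, Sum.inr, hl, hr, ?_, ?_, ?_⟩
  · have h1 : Φ (Fin.last N) = (ultralimit U P).pt := by simp only [Φ, hlast]; rfl
    have h2 : Ψ (Fin.last N) = (P i).pt := by simp only [Ψ, hlast]; rfl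
    have := hglue (Fin.last N)
    rw [h1, h2] at this
    rw [this]
    linarith
  · rintro _ ⟨z, hz, rfl⟩
    obtain ⟨k, hk⟩ := exists_dist_ultralimit_lt hη0 hc z hz
    refine mem_thickening_iff.2 ⟨_, ⟨Ψ k, rfl⟩, (dist_triangle _ (Sum.inl (Φ k)) _).trans_lt ?_⟩
    rw [hglue, hl.dist_eq]
    have : dist z (Φ k) < 2 * η := hk
    linarith
  · rintro _ ⟨y, hy, rfl⟩
    obtain ⟨k, hk⟩ := hci y (closedBall_subset_closedBall (by linarith) hy)
    refine mem_thickening_iff.2 ⟨_, ⟨Φ k, rfl⟩, (dist_triangle _ (Sum.inr (Ψ k)) _).trans_lt ?_⟩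
    rw [dist_comm (Sum.inr (Ψ k)), hglue, hr.dist_eq]
    have : dist y (Ψ k) < η := hk
    linarith

end Ultralimit

/-! ### Tangent sets along prescribed scales -/

/-- Small radii `r` and large dilation factors `t` correspond through `r = a / t`. -/
lemma eventually_atTop_div_iff {a : ℝ} (ha : 0 < a) {p : ℝ → Prop} :
    (∀ᶠ t : {t : ℝ // 0 < t} in atTop, p (a / t.1)) ↔ ∀ᶠ r in 𝓝[>] (0 : ℝ), p r := by
  have : Nonempty {t : ℝ // 0 < t} := ⟨⟨1, one_pos⟩⟩
  constructor
  · intro h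
    obtain ⟨⟨s, hs⟩, h⟩ := eventually_atTop.1 h
    filter_upwards [Ioo_mem_nhdsGT (div_pos ha hs)] with r hr
    have := h ⟨a / r, div_pos ha hr.1⟩ (Subtype.mk_le_mk.2 ((le_div_comm₀ hr.1 hs).1 hr.2.le))
    rwa [div_div_cancel₀ ha.ne'] at this
  · intro h
    obtain ⟨b, hb, h⟩ := mem_nhdsGT_iff_exists_Ioo_subset.1 h
    filter_upwards [eventually_ge_atTop (⟨a / (b / 2), div_pos ha (half_pos hb)⟩ : {t : ℝ // 0 < t})]
      with t ht
    exact h ⟨div_pos ha t.2,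
      ((div_le_comm₀ (half_pos hb) t.2).1 (Subtype.mk_le_mk.1 ht)).trans_lt (half_lt_self hb)⟩

lemma frequently_atTop_div_iff {a : ℝ} (ha : 0 < a) {p : ℝ → Prop} :
    (∃ᶠ t : {t : ℝ // 0 < t} in atTop, p (a / t.1)) ↔ ∃ᶠ r in 𝓝[>] (0 : ℝ), p r :=
  not_congr (eventually_atTop_div_iff ha (p := fun r => ¬ p r))

section Tangent

variable {X : Type u} [MetricSpace X] {x : X}

lemma LocalCompactnessCondition.uniformlyCovered (hx : LocalCompactnessCondition X x)
    {U : Ultrafilter {t : ℝ // 0 < t}} (hU : (U : Filter {t : ℝ // 0 < t}) ≤ atTop) :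
    UniformlyCovered U fun t => scaled X x t.1 t.2 := by
  intro R ε hR hε
  have h := hx (ε / R) (div_pos hε hR)
  obtain ⟨N, hN⟩ := ENat.ne_top_iff_exists.1 h.ne
  have h2 : ∀ᶠ r in 𝓝[>] (0 : ℝ), coverNum (ε / R * r) (closedBall x r) < (N + 1 : ℕ) :=
    eventually_lt_of_limsup_lt (by rw [← hN]; exact_mod_cast N.lt_succ_self)
  refine ⟨N + 1, hU ?_⟩
  filter_upwards [(eventually_atTop_div_iff hR).2 h2] with t ht
  rw [coverNum_scaled]
  have : ε / t.1 = ε / R * (R / t.1) := by field_simp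
  rw [this]
  exact ht.le

/-- Precompactness: among dilation factors occurring frequently, some tend to infinity with the
dilated spaces converging to a tangent set. It is the ultralimit along an ultrafilter concentrated
on these factors. -/
lemma LocalCompactnessCondition.exists_tangentSet (hx : LocalCompactnessCondition X x)
    {p : {t : ℝ // 0 < t} → Prop} (hp : ∃ᶠ t in atTop, p t) :
    ∃ T ∈ tangentSets X x, ∀ R ε : ℝ, 0 < R → 0 < ε →
      ∃ t, p t ∧ EpsClose R ε T (scaled X x t.1 t.2) := by
  have hne : NeBot (atTop ⊓ 𝓟 {t | p t}) := frequently_mem_iff_neBot.1 hp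
  let U := Ultrafilter.of (atTop ⊓ 𝓟 {t | p t})
  have hU : (U : Filter _) ≤ atTop ⊓ 𝓟 {t | p t} := Ultrafilter.of_le _
  have hUtop := hU.trans inf_le_left
  have hUp : ∀ᶠ t in (U : Filter _), p t := le_principal_iff.1 (hU.trans inf_le_right)
  have H := hx.uniformlyCovered hUtop
  refine ⟨ultralimit U _, ⟨H.properSpace_ultralimit, fun R ε hR hε _ => ?_⟩, fun R ε hR hε => ?_⟩
  · exact ((H.eventually_epsClose hR (half_pos hε)).frequently.filter_mono hUtop).mono
      fun t ht => ht.mem_pghNhd (half_pos hε) (half_lt_self hε)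
  · exact (hUp.and (H.eventually_epsClose hR hε)).exists

/-! ### Comparison of the covering numbers at each relative scale -/

variable {l : ℝ}

lemma frequently_compare_of_mem_tangentSets (hl : 0 < l) {T : PointedMetricSpace.{u}}
    (hT : T ∈ tangentSets X x) :
    (∃ᶠ r in 𝓝[>] (0 : ℝ),
      coverNum (4 * l) (closedBall T.pt 1) ≤ coverNum (l * r) (closedBall x r)) ∧
    (∃ᶠ r in 𝓝[>] (0 : ℝ),
      coverNum (4 * l * r) (closedBall x r) ≤ coverNum l (closedBall T.pt 1)) := by
  have hε : 0 < min (l / 2) (1 / 4) := lt_min (by positivity) (by norm_num)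
  have h := hT.2 (2 + 2 * l) (min (l / 2) (1 / 4)) (by positivity) hε
    ((min_le_right _ _).trans_lt (by norm_num))
  have h' := h.mono fun t ht => (EpsClose.of_mem_pghNhd ht).coverNum_scaled_compare t.2 hl hε
    (min_le_left _ _) (min_le_right _ _)
  constructor
  · exact (frequently_atTop_div_iff two_pos).1 (h'.mono fun t ht => ht.1)
  · refine (frequently_atTop_div_iff (a := 1 / 2) (by norm_num)).1 (h'.mono fun t ht => ?_)
    rw [div_div]
    exact ht.2

lemma LocalCompactnessCondition.exists_tangentSet_le (hx : LocalCompactnessCondition X x)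
    (hl : 0 < l) {p : ℝ → Prop} (hp : ∃ᶠ r in 𝓝[>] (0 : ℝ), p r) :
    ∃ T ∈ tangentSets X x, ∃ r, p r ∧
      coverNum (4 * l) (closedBall T.pt 1) ≤ coverNum (l * r) (closedBall x r) := by
  have hε : 0 < min (l / 2) (1 / 4) := lt_min (by positivity) (by norm_num)
  obtain ⟨T, hT, h⟩ := hx.exists_tangentSet ((frequently_atTop_div_iff two_pos).2 hp)
  obtain ⟨t, ht, hc⟩ := h (2 + 2 * l) _ (by positivity) hε
  exact ⟨T, hT, _, ht,
    (hc.coverNum_scaled_compare t.2 hl hε (min_le_left _ _) (min_le_right _ _)).1⟩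

lemma LocalCompactnessCondition.exists_le_tangentSet (hx : LocalCompactnessCondition X x)
    (hl : 0 < l) {p : ℝ → Prop} (hp : ∃ᶠ r in 𝓝[>] (0 : ℝ), p r) :
    ∃ T ∈ tangentSets X x, ∃ r, p r ∧
      coverNum (4 * l * r) (closedBall x r) ≤ coverNum l (closedBall T.pt 1) := by
  have hε : 0 < min (l / 2) (1 / 4) := lt_min (by positivity) (by norm_num)
  obtain ⟨T, hT, h⟩ := hx.exists_tangentSet
    ((frequently_atTop_div_iff (a := 1 / 2) (by norm_num)).2 hp)
  obtain ⟨t, ht, hc⟩ := h (2 + 2 * l) _ (by positivity) hε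
  refine ⟨T, hT, _, ht, ?_⟩
  rw [div_div]
  exact (hc.coverNum_scaled_compare t.2 hl hε (min_le_left _ _) (min_le_right _ _)).2

/-- The logarithm of a covering number. -/
noncomputable def logCover {Y : Type u} [MetricSpace Y] (r : ℝ) (E : Set Y) : EReal :=
  ENNReal.log (coverNum r E : ℝ≥0∞)

lemma logCover_le_logCover {Y Z : Type u} [MetricSpace Y] [MetricSpace Z] {r s : ℝ} {E : Set Y}
    {F : Set Z} (h : coverNum r E ≤ coverNum s F) : logCover r E ≤ logCover s F :=
  ENNReal.log_le_log (ENat.toENNReal_le.2 h)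

lemma iSup_tangentSets_le_limsup (hl : 0 < l) :
    ⨆ T ∈ tangentSets X x, logCover (4 * l) (closedBall T.pt 1) ≤
      limsup (fun r => logCover (l * r) (closedBall x r)) (𝓝[>] 0) :=
  iSup₂_le fun _ hT => le_limsup_of_frequently_le
    ((frequently_compare_of_mem_tangentSets hl hT).1.mono fun _ => logCover_le_logCover)

lemma liminf_le_iInf_tangentSets (hl : 0 < l) :
    liminf (fun r => logCover (4 * l * r) (closedBall x r)) (𝓝[>] 0) ≤
      ⨅ T ∈ tangentSets X x, logCover l (closedBall T.pt 1) :=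
  le_iInf₂ fun _ hT => liminf_le_of_frequently_le
    ((frequently_compare_of_mem_tangentSets hl hT).2.mono fun _ => logCover_le_logCover)

lemma LocalCompactnessCondition.limsup_le_iSup_tangentSets (hx : LocalCompactnessCondition X x)
    (hl : 0 < l) :
    limsup (fun r => logCover (4 * l * r) (closedBall x r)) (𝓝[>] 0) ≤
      ⨆ T ∈ tangentSets X x, logCover l (closedBall T.pt 1) := by
  by_contra! h
  obtain ⟨T, hT, r, hr, hle⟩ := hx.exists_le_tangentSet hl
    (frequently_lt_of_lt_limsup (by isBoundedDefault) h)
  exact hr.not_ge ((logCover_le_logCover hle).trans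
    (le_iSup₂ (f := fun T (_ : T ∈ tangentSets X x) => logCover l (closedBall T.pt 1)) T hT))

lemma LocalCompactnessCondition.iInf_tangentSets_le_liminf (hx : LocalCompactnessCondition X x)
    (hl : 0 < l) :
    ⨅ T ∈ tangentSets X x, logCover (4 * l) (closedBall T.pt 1) ≤
      liminf (fun r => logCover (l * r) (closedBall x r)) (𝓝[>] 0) := by
  by_contra! h
  obtain ⟨T, hT, r, hr, hle⟩ := hx.exists_tangentSet_le hl
    (frequently_lt_of_liminf_lt (by isBoundedDefault) h)
  exact hr.not_ge ((iInf₂_le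
    (f := fun T (_ : T ∈ tangentSets X x) => logCover (4 * l) (closedBall T.pt 1)) T hT).trans
    (logCover_le_logCover hle))

end Tangent

/-! ### Logarithmic ratios -/

/-- Multiplicative change of the scale does not matter in a ratio with `log (1 / l)`, as it changes
the denominator by a bounded amount while the denominator tends to infinity. -/
lemma eventually_div_log_le {F G : ℝ → EReal} (h : ∀ l, 0 < l → F (4 * l) ≤ G l) {a b : ℝ}
    (hab : b < a) : ∀ᶠ l in 𝓝[>] (0 : ℝ), G l / (Real.log (1 / l) : ℝ) ≤ b →
      F (4 * l) / (Real.log (1 / (4 * l)) : ℝ) ≤ a := by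
  have hlim : Tendsto (fun l : ℝ => Real.log (1 / l)) (𝓝[>] 0) atTop := by
    simp only [one_div]
    exact Real.tendsto_log_atTop.comp tendsto_inv_nhdsGT_zero
  filter_upwards [self_mem_nhdsWithin, hlim.eventually_gt_atTop (Real.log 4),
    hlim.eventually_ge_atTop (a * Real.log 4 / (a - b))] with l hl h1 h2 hG
  have hl0 : (0 : ℝ) < l := hl
  have h4 : 0 < Real.log 4 := Real.log_pos (by norm_num)
  have hlog : Real.log (1 / (4 * l)) = Real.log (1 / l) - Real.log 4 := by
    rw [one_div, one_div, Real.log_inv, Real.log_inv, Real.log_mul (by norm_num) hl0.ne']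
    ring
  rw [EReal.div_le_iff_le_mul (by exact_mod_cast h4.trans h1) (EReal.coe_ne_top _)] at hG
  rw [EReal.div_le_iff_le_mul (by rw [hlog]; exact_mod_cast sub_pos.2 h1) (EReal.coe_ne_top _)]
  refine (h l hl0).trans (hG.trans ?_)
  rw [div_le_iff₀ (sub_pos.2 hab)] at h2
  rw [hlog]
  norm_cast
  linarith

lemma tendsto_const_mul_nhdsGT_zero {c : ℝ} (hc : 0 < c) :
    Tendsto (fun l : ℝ => c * l) (𝓝[>] 0) (𝓝[>] 0) := by
  refine tendsto_nhdsWithin_iff.2 ⟨?_, ?_⟩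
  · have : Tendsto (fun l : ℝ => c * l) (𝓝 0) (𝓝 (c * 0)) :=
      tendsto_id.const_mul c
    rw [mul_zero] at this
    exact this.mono_left nhdsWithin_le_nhds
  · filter_upwards [self_mem_nhdsWithin] with l hl
    exact mul_pos hc hl

lemma limsup_div_log_le {F G : ℝ → EReal} (h : ∀ l, 0 < l → F (4 * l) ≤ G l) :
    limsup (fun l => F l / (Real.log (1 / l) : ℝ)) (𝓝[>] 0) ≤
      limsup (fun l => G l / (Real.log (1 / l) : ℝ)) (𝓝[>] 0) := by
  refine le_of_forall_gt_imp_ge_of_dense fun c hc => ?_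
  obtain ⟨a, ha, hac⟩ := EReal.lt_iff_exists_real_btwn.1 hc
  obtain ⟨b, hb, hba⟩ := EReal.lt_iff_exists_real_btwn.1 ha
  refine le_trans (limsup_le_of_le (by isBoundedDefault) ?_) hac.le
  have h1 := (eventually_lt_of_limsup_lt hb).and
    (eventually_div_log_le h (EReal.coe_lt_coe_iff.1 hba))
  filter_upwards [(tendsto_const_mul_nhdsGT_zero (c := 1 / 4) (by norm_num)).eventually h1]
    with l hl
  have := hl.2 hl.1.le
  rwa [show 4 * (1 / 4 * l) = l by ring] at this

lemma liminf_div_log_le {F G : ℝ → EReal} (h : ∀ l, 0 < l → F (4 * l) ≤ G l) :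
    liminf (fun l => F l / (Real.log (1 / l) : ℝ)) (𝓝[>] 0) ≤
      liminf (fun l => G l / (Real.log (1 / l) : ℝ)) (𝓝[>] 0) := by
  refine le_of_forall_gt_imp_ge_of_dense fun c hc => ?_
  obtain ⟨a, ha, hac⟩ := EReal.lt_iff_exists_real_btwn.1 hc
  obtain ⟨b, hb, hba⟩ := EReal.lt_iff_exists_real_btwn.1 ha
  refine le_trans (liminf_le_of_frequently_le ?_) hac.le
  have h1 := (frequently_lt_of_liminf_lt (by isBoundedDefault) hb).and_eventually
    (eventually_div_log_le h (EReal.coe_lt_coe_iff.1 hba))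
  exact (tendsto_const_mul_nhdsGT_zero four_pos).frequently (h1.mono fun l hl => hl.2 hl.1.le)

/-- Division by a positive real number as an order isomorphism, through which suprema, infima,
superior and inferior limits pass. -/
noncomputable def divOrderIso (c : ℝ) (hc : 0 < c) : EReal ≃o EReal where
  toFun a := a / c
  invFun a := a * c
  left_inv a := EReal.div_mul_cancel (EReal.coe_ne_bot _) (EReal.coe_ne_top _)
    (by exact_mod_cast hc.ne')
  right_inv a := by
    change a * c / c = a
    rw [EReal.div_eq_iff (EReal.coe_ne_bot _) (EReal.coe_ne_top _) (by exact_mod_cast hc.ne')]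
  map_rel_iff' := (EReal.strictMono_div_right_of_pos (by exact_mod_cast hc)
    (EReal.coe_ne_top _)).le_iff_le

lemma eventually_log_one_div_pos : ∀ᶠ l in 𝓝[>] (0 : ℝ), 0 < Real.log (1 / l) := by
  filter_upwards [Ioo_mem_nhdsGT one_pos] with l hl
  exact Real.log_pos ((one_lt_div hl.1).2 hl.2)

section Ratio

variable {X : Type u} [MetricSpace X] (x : X)

lemma upperTangentialDim_univ : upperTangentialDim (Set.univ : Set X) x =
    limsup (fun l => limsup (fun r => logCover (l * r) (closedBall x r)) (𝓝[>] 0) /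
      (Real.log (1 / l) : ℝ)) (𝓝[>] 0) := by
  refine limsup_congr (eventually_log_one_div_pos.mono fun l hl => ?_)
  simp only [Set.univ_inter]
  exact ((divOrderIso _ hl).limsup_apply (u := fun r => logCover (l * r) (closedBall x r))).symm

lemma lowerTangentialDim_univ : lowerTangentialDim (Set.univ : Set X) x =
    liminf (fun l => liminf (fun r => logCover (l * r) (closedBall x r)) (𝓝[>] 0) /
      (Real.log (1 / l) : ℝ)) (𝓝[>] 0) := by
  refine liminf_congr (eventually_log_one_div_pos.mono fun l hl => ?_)
  simp only [Set.univ_inter]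
  exact ((divOrderIso _ hl).liminf_apply (u := fun r => logCover (l * r) (closedBall x r))).symm

lemma limsup_iSup_logRatio (S : Set PointedMetricSpace.{u}) :
    limsup (fun l : ℝ => ⨆ T ∈ S, logRatio (coverNum l (closedBall T.pt 1)) l) (𝓝[>] 0) =
      limsup (fun l => (⨆ T ∈ S, logCover l (closedBall T.pt 1)) / (Real.log (1 / l) : ℝ))
        (𝓝[>] 0) :=
  limsup_congr (eventually_log_one_div_pos.mono fun l hl =>
    ((divOrderIso _ hl).map_iSup₂ fun T (_ : T ∈ S) => logCover l (closedBall T.pt 1)).symm)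

lemma liminf_iInf_logRatio (S : Set PointedMetricSpace.{u}) :
    liminf (fun l : ℝ => ⨅ T ∈ S, logRatio (coverNum l (closedBall T.pt 1)) l) (𝓝[>] 0) =
      liminf (fun l => (⨅ T ∈ S, logCover l (closedBall T.pt 1)) / (Real.log (1 / l) : ℝ))
        (𝓝[>] 0) :=
  liminf_congr (eventually_log_one_div_pos.mono fun l hl =>
    ((divOrderIso _ hl).map_iInf₂ fun T (_ : T ∈ S) => logCover l (closedBall T.pt 1)).symm)

end Ratio

end TangentialDim

theorem mainTheorem1 {X : Type u} [MetricSpace X] (x : X)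
    (hx : TangentialDim.LocalCompactnessCondition X x) :
    TangentialDim.upperTangentialDim (Set.univ : Set X) x =
      limsup (fun r : ℝ => ⨆ T ∈ TangentialDim.tangentSets X x,
        TangentialDim.logRatio (TangentialDim.coverNum r (closedBall T.pt 1)) r) (𝓝[>] 0) ∧
    TangentialDim.lowerTangentialDim (Set.univ : Set X) x =
      liminf (fun r : ℝ => ⨅ T ∈ TangentialDim.tangentSets X x,
        TangentialDim.logRatio (TangentialDim.coverNum r (closedBall T.pt 1)) r) (𝓝[>] 0) := by
  open TangentialDim in
  rw [upperTangentialDim_univ, lowerTangentialDim_univ, limsup_iSup_logRatio, liminf_iInf_logRatio]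
  exact ⟨le_antisymm (limsup_div_log_le fun _ => hx.limsup_le_iSup_tangentSets)
      (limsup_div_log_le fun _ => TangentialDim.iSup_tangentSets_le_limsup),
    le_antisymm (liminf_div_log_le fun _ => TangentialDim.liminf_le_iInf_tangentSets)
      (liminf_div_log_le fun _ => hx.iInf_tangentSets_le_liminf)⟩
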